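/- Let $\mathcal{L}$ be a family of maximal lattice-free rational polyhedra in $\mathbb{R}^2$. Then the following conditions are equivalent: (i) $m(\mathcal{L}) < +\infty$; (ii) $\mathcal{L}$ is finite up to $\mathbb{Z}^2$-equivalence. Here a set $L \subseteq \mathbb{R}^d$ is called lattice-free if it is a $d$-dimensional closed convex set whose interior contains no point of $\mathbb{Z}^d$, and maximal lattice-free if moreover it is not properly contained in another lattice-free set. A rational polyhedron is the solution set of finitely many linear inequalities with rational coefficients and right-hand sides. For a $d$-dimensional rational polyhedron $L \ne \mathbb{R}^d$ whose recession cone is a linear space, the max-facet-width $m(L)$ is the minimal positive integer $m$ such that $$L = \{x \in \mathbb{R}^d : b_i - m \le \langle a_i, x\rangle \le b_i \text{ for all } i = 1,\dots,n\}$$ for some $n \ge 1$, $a_1,\dots,a_n \in \mathbb{Z}^d \setminus \{0\}$ and $b_1,\dots,b_n \in \mathbb{Z}$; if $L = \mathbb{R}^d$ or the recession cone of $L$ is not a linear space, then $m(L) := +\infty$. For a family, $m(\mathcal{L}) := \sup_{L \in \mathcal{L}} m(L)$. Sets $X, Y \subseteq \mathbb{R}^d$ are $\mathbb{Z}^d$-equivalent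 if $Y = U(X) + b$ for some unimodular matrix $U \in \mathbb{Z}^{d\times d}$ (that is, $\det U = \pm 1$) and some $b \in \mathbb{Z}^d$. A family $\mathcal{X}$ of subsets of $\mathbb{R}^d$ is finite up to $\mathbb{Z}^d$-equivalence if there are finitely many sets $X_1,\dots,X_t \subseteq \mathbb{R}^d$ such that each $X \in \mathcal{X}$ is $\mathbb{Z}^d$-equivalent to some $X_i$. -/

import Mathlib

open scoped Matrix

/-! Subsets of `ℝ^d` are modelled as subsets of `Fin d → ℝ`; only the topology, the linear structure
and the standard scalar product `a ⬝ᵥ x` are used. -/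

namespace LatticeFree

/-- The vector of `ℝ^d` with the given integer coordinates. -/
def intVec {d : ℕ} (z : Fin d → ℤ) : Fin d → ℝ := fun j => (z j : ℝ)

/-- The lattice `ℤ^d` inside `ℝ^d`. -/
def intLattice (d : ℕ) : Set (Fin d → ℝ) := Set.range intVec

/-- A rational polyhedron in `ℝ^d`: the solution set of finitely many (possibly zero) linear
inequalities `⟨a i, x⟩ ≤ b i` with rational coefficients and rational right-hand sides. -/
def IsRationalPolyhedron {d : ℕ} (L : Set (Fin d → ℝ)) : Prop :=
  ∃ (n : ℕ) (a : Fin n → Fin d → ℚ) (b : Fin n → ℚ),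
    L = {x | ∀ i, (fun j => (a i j : ℝ)) ⬝ᵥ x ≤ (b i : ℝ)}

/-- The recession cone of `L`. -/
def recessionCone {d : ℕ} (L : Set (Fin d → ℝ)) : Set (Fin d → ℝ) :=
  {u | ∀ x ∈ L, ∀ t : ℝ, 0 ≤ t → x + t • u ∈ L}

/-- The recession cone of `L` is a linear subspace. -/
def RecessionConeIsLinear {d : ℕ} (L : Set (Fin d → ℝ)) : Prop :=
  ∃ V : Submodule ℝ (Fin d → ℝ), (V : Set (Fin d → ℝ)) = recessionCone L

/-- `L = {x : b i - m ≤ ⟨a i, x⟩ ≤ b i for all i}` for some `n ≥ 1`, nonzero integer vectors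
`a 1, …, a n` and integers `b 1, …, b n`. -/
def HasFacetWidthRep {d : ℕ} (L : Set (Fin d → ℝ)) (m : ℕ) : Prop :=
  ∃ (n : ℕ) (a : Fin n → Fin d → ℤ) (b : Fin n → ℤ), 0 < n ∧ (∀ i, a i ≠ 0) ∧
    L = {x | ∀ i, (b i : ℝ) - (m : ℝ) ≤ intVec (a i) ⬝ᵥ x ∧ intVec (a i) ⬝ᵥ x ≤ (b i : ℝ)}

open Classical in
/-- The max-facet-width `m(L)` of a `d`-dimensional rational polyhedron `L`: it is `+∞` if
`L = ℝ^d` or the recession cone of `L` is not a linear space, and otherwise the least positive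
integer `m` for which `L` has a representation as in `HasFacetWidthRep`. -/
noncomputable def maxFacetWidth {d : ℕ} (L : Set (Fin d → ℝ)) : ℕ∞ :=
  if L = Set.univ ∨ ¬ RecessionConeIsLinear L then ⊤
  else ⨅ (m : ℕ) (_ : 0 < m ∧ HasFacetWidthRep L m), (m : ℕ∞)

/-- The max-facet-width `m(𝓛)` of a family: the supremum of `m(L)` over `L ∈ 𝓛`. -/
noncomputable def familyMaxFacetWidth {d : ℕ} (𝓛 : Set (Set (Fin d → ℝ))) : ℕ∞ :=
  ⨆ L ∈ 𝓛, maxFacetWidth L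

/-- A lattice-free set: a `d`-dimensional closed convex subset of `ℝ^d` without integer points in
its interior. -/
structure IsLatticeFree {d : ℕ} (L : Set (Fin d → ℝ)) : Prop where
  isClosed : IsClosed L
  convex : Convex ℝ L
  fullDim : affineSpan ℝ L = ⊤
  interior_inter : interior L ∩ intLattice d = ∅

/-- A maximal lattice-free set: a lattice-free set that is not properly contained in another
lattice-free set. -/
def IsMaximalLatticeFree {d : ℕ} (L : Set (Fin d → ℝ)) : Prop :=
  Maximal IsLatticeFree L

/-- `X` and `Y` are `ℤ^d`-equivalent: `Y = U(X) + b` for a unimodular (integer, of determinant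
`±1`) matrix `U` and an integer vector `b`. -/
def IsIntEquivalent {d : ℕ} (X Y : Set (Fin d → ℝ)) : Prop :=
  ∃ (U : Matrix (Fin d) (Fin d) ℤ) (b : Fin d → ℤ), (U.det = 1 ∨ U.det = -1) ∧
    Y = (fun x => (U.map (Int.cast : ℤ → ℝ)) *ᵥ x + intVec b) '' X

/-- The family `𝓧` is finite up to `ℤ^d`-equivalence. -/
def IsFiniteUpToIntEquivalence {d : ℕ} (𝓧 : Set (Set (Fin d → ℝ))) : Prop :=
  ∃ (t : ℕ) (Y : Fin t → Set (Fin d → ℝ)), ∀ X ∈ 𝓧, ∃ i, IsIntEquivalent X (Y i)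

end LatticeFree

/-!
The heart of the matter is that a planar maximal lattice-free set `L` of facet width `m` contains a
unimodular lattice triangle. An equivalence moves this triangle to the one with vertices `0`, `e₁`,
`e₂`, and evaluating the inequalities `b i - m ≤ ⟨a i, x⟩ ≤ b i` at these vertices shows that `b i`
lies in `[0, m]` and the entries of `a i` in `[-m, m]`. Hence there are only finitely many normal
forms of width `m`, and a bounded max-facet-width leaves finitely many classes.

To find the triangle, write `L` by integer inequalities `⟨c k, x⟩ ≤ e k`. Relaxing some of them by
`1/2` brings no new lattice point into the interior, as long as each lattice point of `L` stays on
the line of an inequality that is kept; by maximality the relaxed set is still `L`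
(`IsMaximalLatticeFree.dotProduct_nonpos_of_cover`). If the lattice points of `L` were collinear,
one or two kept inequalities would suffice, and these cannot describe `L`, which is bounded in the
direction of each `c k`, unless `L` is a strip, which contains non-collinear lattice points anyway
(`IsMaximalLatticeFree.exists_noncollinear`). A lattice triangle in a convex set is then shrunk
until it is unimodular (`exists_unimodular_triangle`).

Conversely, max-facet-width is invariant under equivalence
(`HasFacetWidthRep.of_isIntEquivalent`), so it suffices that it is finite for each single `L`. The
recession cone of `L` is linear: for a recession direction `u`, the cylinder `L + ℝ u` is again
lattice-free because multiples of `u` approximate lattice vectors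
(`IsMaximalLatticeFree.recessionConeIsLinear`). Modulo its recession space `L` is bounded, so each
of its defining linear forms is bounded on it
(`IsRationalPolyhedron.exists_hasFacetWidthRep`).
-/

open scoped Pointwise

namespace LatticeFree

lemma intVec_zero {d : ℕ} : intVec (0 : Fin d → ℤ) = 0 := by
  ext j
  simp [intVec]

lemma intVec_dotProduct_intVec {d : ℕ} (a z : Fin d → ℤ) :
    intVec a ⬝ᵥ intVec z = ((a ⬝ᵥ z : ℤ) : ℝ) := by
  simp [intVec, dotProduct]

/-! ### Maximal lattice-free sets have a linear recession cone -/

/-- Simultaneous Diophantine approximation: arbitrarily large multiples of `u` come arbitrarily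
close to the lattice. -/
lemma exists_large_smul_near_intVec {d : ℕ} (u : Fin d → ℝ) {ε : ℝ} (hε : 0 < ε) (T : ℝ) :
    ∃ (s : ℝ) (w : Fin d → ℤ), T ≤ s ∧ dist (s • u) (intVec w) < ε := by
  obtain ⟨N, hN⟩ := exists_nat_ge T
  -- Pigeonhole: the fractional parts of the multiples of `N • u` accumulate in the unit cube.
  let x : ℕ → Fin d → ℝ := fun k j => Int.fract ((k : ℝ) * N * u j)
  have hx : ∀ k, x k ∈ Set.Icc (0 : Fin d → ℝ) 1 := fun k =>
    ⟨fun j => Int.fract_nonneg _, fun j => (Int.fract_lt_one _).le⟩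
  obtain ⟨a, -, φ, hφ, ha⟩ := isCompact_Icc.tendsto_subseq hx
  obtain ⟨k, hk⟩ := Metric.cauchySeq_iff.1 ha.cauchySeq ε hε
  have hlt : φ k + 1 ≤ φ (k + 1) := hφ (Nat.lt_succ_self k)
  have hlt' : (φ k : ℝ) + 1 ≤ φ (k + 1) := by exact_mod_cast hlt
  refine ⟨((φ (k + 1) : ℝ) - φ k) * N,
    fun j => ⌊(φ (k + 1) : ℝ) * N * u j⌋ - ⌊(φ k : ℝ) * N * u j⌋, ?_, ?_⟩
  · have : (0 : ℝ) ≤ N := Nat.cast_nonneg N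
    nlinarith
  · refine lt_of_eq_of_lt ?_ (hk (k + 1) (Nat.le_succ k) k le_rfl)
    rw [dist_eq_norm, dist_eq_norm]
    congr 1
    ext j
    simp only [Pi.sub_apply, Pi.smul_apply, smul_eq_mul, intVec, Function.comp, x, Int.fract]
    push_cast
    ring

lemma IsLatticeFree.interior_nonempty {d : ℕ} {L : Set (Fin d → ℝ)} (hL : IsLatticeFree L) :
    (interior L).Nonempty :=
  hL.convex.interior_nonempty_iff_affineSpan_eq_top.2 hL.fullDim

lemma IsLatticeFree.ne_univ {d : ℕ} {L : Set (Fin d → ℝ)} (hL : IsLatticeFree L) :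
    L ≠ Set.univ := by
  rintro rfl
  have h : intVec (0 : Fin d → ℤ) ∈ interior (Set.univ : Set (Fin d → ℝ)) ∩ intLattice d := by
    rw [interior_univ]
    exact ⟨trivial, 0, rfl⟩
  rw [hL.interior_inter] at h
  exact h

lemma add_smul_mem_interior {d : ℕ} {L : Set (Fin d → ℝ)} {u x : Fin d → ℝ}
    (hu : u ∈ recessionCone L) (hx : x ∈ interior L) {t : ℝ} (ht : 0 ≤ t) :
    x + t • u ∈ interior L := by
  have hopen : IsOpen ((fun y => y + t • u) '' interior L) :=
    (Homeomorph.addRight (t • u)).isOpenMap _ isOpen_interior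
  refine interior_maximal ?_ hopen ⟨x, hx, rfl⟩
  rintro _ ⟨y, hy, rfl⟩
  exact hu y (interior_subset hy) t ht

/-- The cylinder `interior L + ℝ u` over a recession direction `u` contains no lattice point: a
lattice point in it could be moved by a lattice vector close to a large multiple of `u` into the
interior of `L`. Its closure is therefore lattice-free, and maximality puts it inside `L`. -/
lemma IsMaximalLatticeFree.neg_mem_recessionCone {d : ℕ} {L : Set (Fin d → ℝ)}
    (hL : IsMaximalLatticeFree L) {u : Fin d → ℝ} (hu : u ∈ recessionCone L) :
    -u ∈ recessionCone L := by
  have hLF : IsLatticeFree L := hL.prop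
  let R : Submodule ℝ (Fin d → ℝ) := ℝ ∙ u
  let O : Set (Fin d → ℝ) := interior L + (R : Set (Fin d → ℝ))
  have hmem : ∀ x ∈ interior L, ∀ t : ℝ, x + t • u ∈ O := fun x hx t =>
    Set.add_mem_add hx (R.smul_mem t (Submodule.mem_span_singleton_self u))
  have hOopen : IsOpen O := isOpen_interior.add_right
  have hOconv : Convex ℝ O := hLF.convex.interior.add R.convex
  have hLcl : closure (interior L) = L := by
    rw [hLF.convex.closure_interior_eq_closure_of_nonempty_interior hLF.interior_nonempty,
      hLF.isClosed.closure_eq]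
  have hintO : interior L ⊆ O := fun x hx => by simpa using hmem x hx 0
  have hLO : L ⊆ closure O := by
    rw [← hLcl]
    exact closure_mono hintO
  have hO : IsLatticeFree (closure O) := by
    refine ⟨isClosed_closure, hOconv.closure, ?_, ?_⟩
    · exact top_le_iff.1 (hLF.fullDim ▸ affineSpan_mono ℝ hLO)
    · rw [hOconv.interior_closure_eq_interior_of_nonempty_interior
        (by rw [hOopen.interior_eq]; exact hLF.interior_nonempty.mono hintO), hOopen.interior_eq,
        Set.eq_empty_iff_forall_notMem]
      rintro _ ⟨⟨y, hy, r, hr, hz⟩, z, rfl⟩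
      obtain ⟨t, rfl⟩ := Submodule.mem_span_singleton.1 hr
      obtain ⟨ε, hε, hball⟩ := Metric.isOpen_iff.1 isOpen_interior y hy
      obtain ⟨s, w, hs, hsw⟩ := exists_large_smul_near_intVec u hε (-t)
      have hy' : y + (intVec w - s • u) ∈ interior L := by
        apply hball
        rw [Metric.mem_ball, dist_eq_norm, add_sub_cancel_left, ← dist_eq_norm, dist_comm]
        exact hsw
      have h := add_smul_mem_interior hu hy' (t := s + t) (by linarith)
      have hzw : y + (intVec w - s • u) + (s + t) • u = intVec (z + w) := by
        have : intVec (z + w) = intVec z + intVec w := by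
          ext j; simp [intVec]
        rw [this, ← hz]
        module
      rw [hzw] at h
      have h' : intVec (z + w) ∈ interior L ∩ intLattice d := ⟨h, _, rfl⟩
      rw [hLF.interior_inter] at h'
      exact h'
  have hsub : closure O ⊆ L := hL.2 hO hLO
  intro x hx t _
  apply hsub
  rw [← hLcl] at hx
  refine map_mem_closure (f := fun y => y + t • -u) (by fun_prop) hx fun y hy => ?_
  simpa using hmem y hy (-t)

theorem IsMaximalLatticeFree.recessionConeIsLinear {d : ℕ} {L : Set (Fin d → ℝ)}
    (hL : IsMaximalLatticeFree L) : RecessionConeIsLinear L := by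
  refine ⟨{ carrier := recessionCone L, add_mem' := ?_, zero_mem' := ?_, smul_mem' := ?_ }, rfl⟩
  · intro u v hu hv x hx t ht
    rw [smul_add, ← add_assoc]
    exact hv _ (hu x hx t ht) t ht
  · intro x hx t _
    simpa using hx
  · intro c u hu x hx t ht
    rcases le_total 0 c with hc | hc
    · rw [smul_smul]
      exact hu x hx _ (mul_nonneg ht hc)
    · have := hL.neg_mem_recessionCone hu x hx (t * -c) (mul_nonneg ht (neg_nonneg.2 hc))
      rw [smul_smul]
      simpa using this

/-! ### Rational polyhedra with a linear recession cone have finite max-facet-width -/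

lemma exists_int_eq_mul_of_den_dvd {q : ℚ} {N : ℕ} (h : q.den ∣ N) : ∃ z : ℤ, (z : ℚ) = N * q := by
  obtain ⟨k, rfl⟩ := h
  refine ⟨k * q.num, ?_⟩
  have := Rat.den_mul_eq_num q
  push_cast
  rw [← this]
  ring

/-- Clearing denominators in one rational linear inequality. -/
lemma exists_int_inequality {d : ℕ} (a : Fin d → ℚ) (b : ℚ) :
    ∃ (c : Fin d → ℤ) (e : ℤ), ∀ x : Fin d → ℝ,
      (fun j => (a j : ℝ)) ⬝ᵥ x ≤ (b : ℝ) ↔ intVec c ⬝ᵥ x ≤ (e : ℝ) := by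
  set N : ℕ := b.den * ∏ j, (a j).den with hN
  have hNpos : 0 < N := Nat.mul_pos b.den_pos (Finset.prod_pos fun j _ => (a j).den_pos)
  have hc : ∀ j, ∃ z : ℤ, (z : ℚ) = N * a j := fun j => exists_int_eq_mul_of_den_dvd
    ((Finset.dvd_prod_of_mem (fun j => (a j).den) (Finset.mem_univ j)).mul_left _)
  choose c hc using hc
  obtain ⟨e, he⟩ := exists_int_eq_mul_of_den_dvd (q := b) (N := N) (Dvd.intro _ rfl)
  refine ⟨c, e, fun x => ?_⟩
  have h1 : intVec c = (N : ℝ) • fun j => (a j : ℝ) := by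
    ext j
    have := congrArg (Rat.cast : ℚ → ℝ) (hc j)
    push_cast at this
    simpa [intVec] using this
  have h2 : (e : ℝ) = N * b := by exact_mod_cast congrArg (Rat.cast : ℚ → ℝ) he
  rw [h1, h2, smul_dotProduct, smul_eq_mul]
  exact (mul_le_mul_iff_right₀ (by exact_mod_cast hNpos)).symm

/-- A linear form defining a polyhedron with a linear recession cone `V` is bounded below on it:
it vanishes on `V`, and the intersection of the polyhedron with a complement of `V` is bounded, as
an unbounded sequence in it would have a recession direction as limit direction. -/
lemma exists_lower_bound {d n : ℕ} {L : Set (Fin d → ℝ)} (c : Fin n → Fin d → ℤ) (e : Fin n → ℤ)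
    (hL : L = {x | ∀ i, intVec (c i) ⬝ᵥ x ≤ (e i : ℝ)}) (hne : L.Nonempty)
    (hlin : RecessionConeIsLinear L) :
    ∃ M : ℝ, ∀ i, ∀ x ∈ L, -M ≤ intVec (c i) ⬝ᵥ x := by
  obtain ⟨V, hV⟩ := hlin
  have hcone : ∀ u : Fin d → ℝ, (∀ i, intVec (c i) ⬝ᵥ u ≤ 0) → u ∈ V := by
    intro u hu
    change u ∈ (V : Set (Fin d → ℝ))
    rw [hV]
    intro x hx t ht
    rw [hL] at hx ⊢
    intro i
    rw [dotProduct_add, dotProduct_smul, smul_eq_mul]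
    nlinarith [hx i, mul_nonneg ht (neg_nonneg.2 (hu i))]
  have hsub : ∀ u ∈ V, ∀ i, ∀ x ∈ L, intVec (c i) ⬝ᵥ (x + u) ≤ e i := by
    intro u hu i x hx
    have hu' : u ∈ recessionCone L := by rw [← hV]; exact hu
    have := hu' x hx 1 zero_le_one
    rw [one_smul, hL] at this
    exact this i
  have hvanish : ∀ u ∈ V, ∀ i, intVec (c i) ⬝ᵥ u = 0 := by
    obtain ⟨x, hx⟩ := hne
    have key : ∀ u ∈ V, ∀ i, intVec (c i) ⬝ᵥ u ≤ 0 := by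
      intro u hu i
      by_contra! hpos
      obtain ⟨k, hk⟩ := exists_nat_gt ((e i - intVec (c i) ⬝ᵥ x) / (intVec (c i) ⬝ᵥ u))
      have h := hsub ((k : ℝ) • u) (V.smul_mem _ hu) i x hx
      rw [div_lt_iff₀ hpos] at hk
      rw [dotProduct_add, dotProduct_smul, smul_eq_mul] at h
      linarith
    intro u hu i
    refine le_antisymm (key u hu i) ?_
    have := key (-u) (V.neg_mem hu) i
    rw [dotProduct_neg] at this
    linarith
  obtain ⟨W, hW⟩ := V.exists_isCompl
  have hbdd : ∃ B : ℝ, ∀ x ∈ L, x ∈ W → ‖x‖ ≤ B := by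
    by_contra! hunb
    choose x hxL hxW hxn using fun k : ℕ => hunb ((k : ℝ) + 1)
    have hpos : ∀ k, 0 < ‖x k‖ := fun k => lt_trans (by positivity) (hxn k)
    have hsph : ∀ k, ‖x k‖⁻¹ • x k ∈ Metric.sphere (0 : Fin d → ℝ) 1 := fun k => by
      rw [mem_sphere_zero_iff_norm, norm_smul, norm_inv, norm_norm, inv_mul_cancel₀ (hpos k).ne']
    obtain ⟨y, hy, φ, hφ, hlim⟩ := (isCompact_sphere (0 : Fin d → ℝ) 1).tendsto_subseq hsph
    have hyW : y ∈ W := W.closed_of_finiteDimensional.mem_of_tendsto hlim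
      (Filter.Eventually.of_forall fun k => W.smul_mem _ (hxW _))
    have hinv : Filter.Tendsto (fun k => ‖x k‖⁻¹) Filter.atTop (nhds 0) := by
      refine tendsto_inv_atTop_zero.comp (Filter.tendsto_atTop_mono (fun k => ?_)
        tendsto_natCast_atTop_atTop)
      linarith [hxn k]
    have hyV : y ∈ V := by
      refine hcone y fun i => ?_
      have h1 : Filter.Tendsto (fun k => intVec (c i) ⬝ᵥ (‖x (φ k)‖⁻¹ • x (φ k))) Filter.atTop
          (nhds (intVec (c i) ⬝ᵥ y)) :=
        ((continuous_const.dotProduct continuous_id).tendsto y).comp hlim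
      have h2 : Filter.Tendsto (fun k => ‖x (φ k)‖⁻¹ * (e i : ℝ)) Filter.atTop (nhds 0) := by
        simpa using (hinv.comp hφ.tendsto_atTop).mul_const (e i : ℝ)
      refine le_of_tendsto_of_tendsto' h1 h2 fun k => ?_
      have hx := hxL (φ k)
      rw [hL] at hx
      rw [dotProduct_smul, smul_eq_mul]
      exact mul_le_mul_of_nonneg_left (hx i) (inv_nonneg.2 (norm_nonneg _))
    have hy0 : y = 0 := Submodule.disjoint_def.1 hW.disjoint y hyV hyW
    rw [hy0] at hy
    simp at hy
  obtain ⟨B, hB⟩ := hbdd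
  have hK : ∀ i, ∃ M : ℝ, ∀ x ∈ Metric.closedBall (0 : Fin d → ℝ) B, ‖intVec (c i) ⬝ᵥ x‖ ≤ M :=
    fun i => (isCompact_closedBall (0 : Fin d → ℝ) B).exists_bound_of_continuousOn
      (continuous_const.dotProduct continuous_id).continuousOn
  choose M hM using hK
  refine ⟨∑ i, |M i|, fun i x hx => ?_⟩
  obtain ⟨v, hv, w, hw, rfl⟩ : ∃ v ∈ V, ∃ w ∈ W, v + w = x :=
    Submodule.mem_sup.1 (hW.sup_eq_top ▸ Submodule.mem_top)
  have hwL : w ∈ L := by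
    rw [hL] at hx ⊢
    intro i
    have := hx i
    rwa [dotProduct_add, hvanish v hv i, zero_add] at this
  have hw' := hM i w (by simpa using hB w hwL hw)
  rw [dotProduct_add, hvanish v hv i, zero_add]
  have hle : |M i| ≤ ∑ i, |M i| :=
    Finset.single_le_sum (f := fun i => |M i|) (fun _ _ => abs_nonneg _) (Finset.mem_univ i)
  have := neg_abs_le (intVec (c i) ⬝ᵥ w)
  rw [Real.norm_eq_abs] at hw'
  linarith [le_abs_self (M i)]

theorem IsRationalPolyhedron.exists_hasFacetWidthRep {d : ℕ} {L : Set (Fin d → ℝ)}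
    (hL : IsRationalPolyhedron L) (hne : L.Nonempty) (huniv : L ≠ Set.univ)
    (hlin : RecessionConeIsLinear L) : ∃ m : ℕ, 0 < m ∧ HasFacetWidthRep L m := by
  obtain ⟨n, a, b, hab⟩ := hL
  choose c e hce using fun i => exists_int_inequality (a i) (b i)
  have hrep : L = {x | ∀ i, intVec (c i) ⬝ᵥ x ≤ (e i : ℝ)} := by
    rw [hab]
    ext x
    exact forall_congr' fun i => hce i x
  obtain ⟨M, hM⟩ := exists_lower_bound c e hrep hne hlin
  have hzero : ∀ i, c i = 0 → (0 : ℝ) ≤ e i := by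
    intro i hi
    obtain ⟨x, hx⟩ := hne
    rw [hrep] at hx
    simpa [hi, intVec_zero] using hx i
  obtain ⟨i₀, hi₀⟩ : ∃ i, c i ≠ 0 := by
    by_contra! h
    apply huniv
    rw [hrep, Set.eq_univ_iff_forall]
    intro x i
    simpa [h i, intVec_zero] using hzero i (h i)
  -- Inequalities with a zero normal are vacuous; they are replaced by copies of the `i₀`-th one.
  let σ : Fin n → Fin n := fun i => if c i = 0 then i₀ else i
  have hσ : ∀ i, c (σ i) ≠ 0 := by
    intro i
    by_cases h : c i = 0
    · simp [σ, h, hi₀]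
    · simp [σ, h]
  obtain ⟨m, hm⟩ := exists_nat_ge (∑ i, |(e i : ℝ)| + M)
  have hle : ∀ i, (e i : ℝ) ≤ ∑ i, |(e i : ℝ)| := fun i =>
    (le_abs_self _).trans
      (Finset.single_le_sum (f := fun i => |(e i : ℝ)|) (fun _ _ => abs_nonneg _)
        (Finset.mem_univ i))
  refine ⟨m + 1, Nat.succ_pos m, n, fun i => c (σ i), fun i => e (σ i), i₀.pos, hσ, ?_⟩
  apply Set.Subset.antisymm
  · intro x hx i
    refine ⟨?_, ?_⟩
    · have h1 := hM (σ i) x hx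
      have h2 := hle (σ i)
      push_cast
      linarith
    · rw [hrep] at hx
      exact hx (σ i)
  · intro x hx
    rw [hrep]
    intro i
    by_cases h : c i = 0
    · simpa [h, intVec_zero] using hzero i h
    · have := (hx i).2
      simpa [σ, h] using this

/-! ### Invariance under `ℤ^d`-equivalence -/

lemma IsIntEquivalent.symm {d : ℕ} {X Y : Set (Fin d → ℝ)} (h : IsIntEquivalent X Y) :
    IsIntEquivalent Y X := by
  obtain ⟨U, b, hU, rfl⟩ := h
  have hunit : IsUnit U.det := Int.isUnit_iff.2 hU
  have hinv : (U⁻¹).map (Int.cast : ℤ → ℝ) * U.map (Int.cast : ℤ → ℝ) = 1 := by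
    have := congrArg (Int.castRingHom ℝ).mapMatrix (Matrix.nonsing_inv_mul U hunit)
    rwa [map_mul, map_one] at this
  have hb : intVec (-(U⁻¹ *ᵥ b)) = -((U⁻¹).map (Int.cast : ℤ → ℝ) *ᵥ intVec b) := by
    ext j
    simp [intVec, Matrix.mulVec, dotProduct]
  refine ⟨U⁻¹, -(U⁻¹ *ᵥ b), ?_, ?_⟩
  · rw [← Int.isUnit_iff]
    exact (Matrix.isUnit_nonsing_inv_det_iff).2 hunit
  · rw [Set.image_image]
    symm
    convert Set.image_id X using 2
    ext x : 1
    rw [hb, Matrix.mulVec_add, Matrix.mulVec_mulVec, hinv, Matrix.one_mulVec,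
      add_neg_cancel_right, id]

lemma HasFacetWidthRep.of_isIntEquivalent {d : ℕ} {X Y : Set (Fin d → ℝ)} {m : ℕ}
    (hX : HasFacetWidthRep X m) (h : IsIntEquivalent X Y) : HasFacetWidthRep Y m := by
  -- The inverse equivalence is substituted into the inequalities defining `X`.
  obtain ⟨U, b, hU, rfl⟩ := h.symm
  obtain ⟨n, a, c, hn, ha, hrep⟩ := hX
  have hunit : IsUnit U.det := Int.isUnit_iff.2 hU
  have hinj : Function.Injective
      fun x : Fin d → ℝ => U.map (Int.cast : ℤ → ℝ) *ᵥ x + intVec b := by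
    intro x y hxy
    have hdet : IsUnit (U.map (Int.cast : ℤ → ℝ)) := by
      have := ((Matrix.isUnit_iff_isUnit_det U).2 hunit).map (Int.castRingHom ℝ).mapMatrix
      exact this
    exact Matrix.mulVec_injective_of_isUnit hdet (add_right_cancel hxy)
  refine ⟨n, fun i => a i ᵥ* U, fun i => c i - a i ⬝ᵥ b, hn, fun i hi => ha i ?_, ?_⟩
  · have := congrArg (fun v => v ᵥ* U⁻¹) hi
    simpa [Matrix.vecMul_vecMul, Matrix.mul_nonsing_inv U hunit] using this
  · ext y
    rw [← hinj.mem_set_image, hrep]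
    refine forall_congr' fun i => ?_
    have h1 : intVec (a i ᵥ* U) = intVec (a i) ᵥ* U.map (Int.cast : ℤ → ℝ) := by
      ext j
      simp [intVec, Matrix.vecMul, dotProduct]
    have h2 : ((a i ⬝ᵥ b : ℤ) : ℝ) = intVec (a i) ⬝ᵥ intVec b := by
      simp [intVec, dotProduct]
    rw [h1, ← Matrix.dotProduct_mulVec, dotProduct_add, Int.cast_sub, h2]
    constructor <;> rintro ⟨h3, h4⟩ <;> constructor <;> linarith

/-! ### Relaxing the inequalities of a maximal lattice-free polyhedron -/

/-- Let `L` be a maximal lattice-free set given by integer inequalities `⟨c k, x⟩ ≤ e k`, and let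
`J` be a set of indices such that every lattice point of `L` attains equality for some `j ∈ J`.
Relaxing the remaining inequalities by `1/2` keeps the set lattice-free, hence, by maximality, does
not change it. So one may move indefinitely in each direction allowed by the inequalities in `J`. -/
lemma IsMaximalLatticeFree.dotProduct_nonpos_of_cover {d : ℕ} {ι : Type*} [Fintype ι]
    {L : Set (Fin d → ℝ)} (hL : IsMaximalLatticeFree L) (c : ι → Fin d → ℤ) (e : ι → ℤ)
    (hc : ∀ k, c k ≠ 0) (hrep : L = {x | ∀ k, intVec (c k) ⬝ᵥ x ≤ (e k : ℝ)}) (J : Set ι)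
    (hJ : ∀ z : Fin d → ℤ, intVec z ∈ L → ∃ j ∈ J, c j ⬝ᵥ z = e j) (v : Fin d → ℤ)
    (hv : ∀ j ∈ J, c j ⬝ᵥ v ≤ 0) (k : ι) : c k ⬝ᵥ v ≤ 0 := by
  classical
  have hLF : IsLatticeFree L := hL.prop
  let f : ι → ℝ := fun k => if k ∈ J then (e k : ℝ) else (e k : ℝ) + 1 / 2
  have hef : ∀ k, (e k : ℝ) ≤ f k := by
    intro k
    by_cases h : k ∈ J
    · simp [f, h]
    · simp [f, h]
  let L' : Set (Fin d → ℝ) := {x | ∀ k, intVec (c k) ⬝ᵥ x ≤ f k}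
  have hLL' : L ⊆ L' := by
    rw [hrep]
    exact fun x hx k => (hx k).trans (hef k)
  have hcont : ∀ k, Continuous fun x : Fin d → ℝ => intVec (c k) ⬝ᵥ x := fun k =>
    continuous_const.dotProduct continuous_id
  have hL' : IsLatticeFree L' := by
    refine ⟨?_, ?_, ?_, ?_⟩
    · have : L' = ⋂ k, {x | intVec (c k) ⬝ᵥ x ≤ f k} := by
        ext x
        simp [L']
      rw [this]
      exact isClosed_iInter fun k => isClosed_le (hcont k) continuous_const
    · intro x hx y hy s t hs ht hst k
      rw [dotProduct_add, dotProduct_smul, dotProduct_smul, smul_eq_mul, smul_eq_mul]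
      have h1 := mul_le_mul_of_nonneg_left (hx k) hs
      have h2 := mul_le_mul_of_nonneg_left (hy k) ht
      have h3 : s * f k + t * f k = f k := by rw [← add_mul, hst, one_mul]
      linarith
    · exact top_le_iff.1 (hLF.fullDim ▸ affineSpan_mono ℝ hLL')
    · rw [Set.eq_empty_iff_forall_notMem]
      rintro _ ⟨hz, z, rfl⟩
      have hzL' : intVec z ∈ L' := interior_subset hz
      -- Integrality of `⟨c k, z⟩` undoes the relaxation.
      have hzL : intVec z ∈ L := by
        rw [hrep]
        intro k
        have h := (hzL' k)
        have hf : f k ≤ (e k : ℝ) + 1 / 2 := by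
          by_cases h : k ∈ J
          · simp [f, h]
          · simp [f, h]
        rw [intVec_dotProduct_intVec] at h ⊢
        have h' : ((c k ⬝ᵥ z : ℤ) : ℝ) < ((e k + 1 : ℤ) : ℝ) := by
          push_cast
          linarith
        exact_mod_cast Int.lt_add_one_iff.1 (by exact_mod_cast h')
      obtain ⟨j, hjJ, hj⟩ := hJ z hzL
      -- As an interior point of `L'`, `z` can be moved slightly in the direction of `c j`.
      have hcz : Filter.Tendsto (fun t : ℝ => intVec z + t • intVec (c j)) (nhds 0)
          (nhds (intVec z)) := by
        have : Continuous fun t : ℝ => intVec z + t • intVec (c j) := by fun_prop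
        simpa using this.tendsto 0
      have hev : ∀ᶠ t in nhdsWithin (0 : ℝ) (Set.Ioi 0), intVec z + t • intVec (c j) ∈ L' :=
        (hcz.mono_left nhdsWithin_le_nhds).eventually (mem_interior_iff_mem_nhds.1 hz)
      obtain ⟨t, htL', ht⟩ := (hev.and self_mem_nhdsWithin).exists
      have h := htL' j
      have hfj : f j = e j := by simp [f, hjJ]
      have hpos : 0 < c j ⬝ᵥ c j :=
        lt_of_le_of_ne (Finset.sum_nonneg fun i _ => mul_self_nonneg _)
          fun h => hc j (dotProduct_self_eq_zero.1 h.symm)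
      rw [dotProduct_add, dotProduct_smul, intVec_dotProduct_intVec, intVec_dotProduct_intVec, hj,
        hfj, smul_eq_mul] at h
      have : (0 : ℝ) < t * ((c j ⬝ᵥ c j : ℤ) : ℝ) := mul_pos ht (by exact_mod_cast hpos)
      linarith
  have hsub : L' ⊆ L := hL.2 hL' hLL'
  set S : ℝ := ∑ k, |intVec (c k) ⬝ᵥ intVec v| with hS
  have hS0 : 0 ≤ S := Finset.sum_nonneg fun _ _ => abs_nonneg _
  set δ : ℝ := 1 / (2 * (S + 1)) with hδ
  have hδ0 : 0 < δ := by positivity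
  have hstep : ∀ x ∈ L, x + δ • intVec v ∈ L := by
    intro x hx
    apply hsub
    intro i
    have hxi : intVec (c i) ⬝ᵥ x ≤ e i := by
      rw [hrep] at hx
      exact hx i
    rw [dotProduct_add, dotProduct_smul, smul_eq_mul]
    by_cases hi : i ∈ J
    · have hvi : intVec (c i) ⬝ᵥ intVec v ≤ 0 := by
        rw [intVec_dotProduct_intVec]
        exact_mod_cast hv i hi
      simp only [f, hi, if_true]
      nlinarith
    · simp only [f, hi, if_false]
      have h1 : intVec (c i) ⬝ᵥ intVec v ≤ S := (le_abs_self _).trans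
        (Finset.single_le_sum (f := fun k => |intVec (c k) ⬝ᵥ intVec v|)
          (fun _ _ => abs_nonneg _) (Finset.mem_univ i))
      have h2 : δ * (intVec (c i) ⬝ᵥ intVec v) ≤ δ * (S + 1) :=
        mul_le_mul_of_nonneg_left (by linarith) hδ0.le
      have h3 : δ * (S + 1) = 1 / 2 := by
        rw [hδ]
        field_simp
      linarith
  obtain ⟨x, hx⟩ : L.Nonempty := hLF.interior_nonempty.mono interior_subset
  have hiter : ∀ n : ℕ, x + ((n : ℝ) * δ) • intVec v ∈ L := by
    intro n
    induction n with
    | zero => simpa using hx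
    | succ n ih =>
      convert hstep _ ih using 1
      push_cast
      module
  by_contra! hpos
  have hpos' : 0 < δ * (intVec (c k) ⬝ᵥ intVec v) := by
    rw [intVec_dotProduct_intVec]
    exact mul_pos hδ0 (by exact_mod_cast hpos)
  obtain ⟨n, hn⟩ := exists_nat_gt ((e k - intVec (c k) ⬝ᵥ x) / (δ * (intVec (c k) ⬝ᵥ intVec v)))
  have h := hiter n
  rw [hrep] at h
  have h' := h k
  rw [div_lt_iff₀ hpos'] at hn
  rw [dotProduct_add, dotProduct_smul, smul_eq_mul] at h'
  linarith

/-! ### Lattice triangles in planar maximal lattice-free polyhedra -/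

/-- The determinant of two integer vectors of the plane. -/
def cross (u v : Fin 2 → ℤ) : ℤ := u 0 * v 1 - u 1 * v 0

/-- Of three distinct collinear points `0`, `u`, `v`, one lies between the other two. -/
lemma exists_between_of_cross_eq_zero {u v : Fin 2 → ℤ} (hu : u ≠ 0) (hv : v ≠ 0) (huv : u ≠ v)
    (h : cross u v = 0) : u ⬝ᵥ v < 0 ∨ (0 - u) ⬝ᵥ (v - u) < 0 ∨ (0 - v) ⬝ᵥ (u - v) < 0 := by
  have hpos : ∀ w : Fin 2 → ℤ, w ≠ 0 → 0 < w ⬝ᵥ w := fun w hw =>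
    lt_of_le_of_ne (Finset.sum_nonneg fun i _ => mul_self_nonneg _)
      fun h => hw (dotProduct_self_eq_zero.1 h.symm)
  have h1 := hpos u hu
  have h2 := hpos v hv
  have h3 := hpos (u - v) (sub_ne_zero.2 huv)
  -- Equality in the Cauchy–Schwarz inequality.
  have h4 : (u ⬝ᵥ v) * (u ⬝ᵥ v) = (u ⬝ᵥ u) * (v ⬝ᵥ v) := by
    simp only [dotProduct, Fin.sum_univ_two, cross] at *
    linear_combination -(u 0 * v 1 - u 1 * v 0) * h
  rw [sub_dotProduct, dotProduct_sub, dotProduct_sub, dotProduct_comm v u] at h3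
  simp only [zero_sub, neg_dotProduct, dotProduct_sub, dotProduct_comm v u]
  by_contra! hcon
  obtain ⟨h5, h6, h7⟩ := hcon
  nlinarith

/-- If `u` and `v` point in opposite directions, a linear form that is nonpositive at both of them
vanishes at `u`, and by symmetry at `v`. -/
lemma dotProduct_eq_zero_of_opposite {a u v : Fin 2 → ℤ} (h : cross u v = 0) (huv : u ⬝ᵥ v < 0)
    (hu : a ⬝ᵥ u ≤ 0) (hv : a ⬝ᵥ v ≤ 0) : a ⬝ᵥ u = 0 := by
  have h1 : (u ⬝ᵥ v) * (a ⬝ᵥ u) = (u ⬝ᵥ u) * (a ⬝ᵥ v) := by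
    simp only [dotProduct, Fin.sum_univ_two, cross] at *
    linear_combination (a 0 * u 1 - a 1 * u 0) * h
  have h2 : 0 ≤ u ⬝ᵥ u := Finset.sum_nonneg fun i _ => mul_self_nonneg _
  nlinarith

/-- A maximal lattice-free polyhedron in the plane that is bounded in all its facet directions
contains three non-collinear lattice points. Otherwise its lattice points would lie on the lines of
at most two of its inequalities, and all the others could be relaxed. -/
lemma IsMaximalLatticeFree.exists_noncollinear {ι : Type*} [Fintype ι] [Nonempty ι]
    {L : Set (Fin 2 → ℝ)} (hL : IsMaximalLatticeFree L) (c : ι → Fin 2 → ℤ) (e : ι → ℤ)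
    (hc : ∀ k, c k ≠ 0) (hneg : ∀ k, ∃ k', c k' = -c k)
    (hrep : L = {x | ∀ k, intVec (c k) ⬝ᵥ x ≤ (e k : ℝ)}) :
    ∃ p u v : Fin 2 → ℤ, intVec p ∈ L ∧ intVec (p + u) ∈ L ∧ intVec (p + v) ∈ L ∧
      cross u v ≠ 0 := by
  have hmem : ∀ z : Fin 2 → ℤ, intVec z ∈ L ↔ ∀ k, c k ⬝ᵥ z ≤ e k := by
    intro z
    rw [hrep]
    refine forall_congr' fun k => ?_
    rw [intVec_dotProduct_intVec]
    exact Int.cast_le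
  have hcover : ∀ (J : Set ι), (∀ z : Fin 2 → ℤ, intVec z ∈ L → ∃ j ∈ J, c j ⬝ᵥ z = e j) →
      ∀ v : Fin 2 → ℤ, (∀ j ∈ J, c j ⬝ᵥ v ≤ 0) → ∀ k, c k ⬝ᵥ v = 0 := by
    intro J hJ v hv k
    have h1 := hL.dotProduct_nonpos_of_cover c e hc hrep J hJ v hv
    obtain ⟨k', hk'⟩ := hneg k
    have h2 := h1 k'
    rw [hk', neg_dotProduct] at h2
    exact le_antisymm (h1 k) (by linarith)
  have htight : ∀ z : Fin 2 → ℤ, intVec z ∈ L → ∃ j, c j ⬝ᵥ z = e j := by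
    intro z hz
    by_contra! h
    have hlt : ∀ k, c k ⬝ᵥ z < e k := fun k => lt_of_le_of_ne ((hmem z).1 hz k) (h k)
    have hopen : IsOpen {x : Fin 2 → ℝ | ∀ k, intVec (c k) ⬝ᵥ x < (e k : ℝ)} := by
      rw [Set.ofPred_forall]
      exact isOpen_iInter_of_finite fun k =>
        isOpen_lt (continuous_const.dotProduct continuous_id) continuous_const
    have hint : intVec z ∈ interior L := by
      refine interior_maximal (fun x hx => ?_) hopen fun k => ?_
      · rw [hrep]
        exact fun k => (hx k).le
      · rw [intVec_dotProduct_intVec]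
        exact_mod_cast hlt k
    have : intVec z ∈ interior L ∩ intLattice 2 := ⟨hint, z, rfl⟩
    rw [hL.prop.interior_inter] at this
    exact this
  -- No single inequality is tight at all lattice points of `L`, by `hcover` with `v = -c j`.
  have hone : ∀ j, ∃ z : Fin 2 → ℤ, intVec z ∈ L ∧ c j ⬝ᵥ z < e j := by
    intro j
    by_contra! h
    have h0 := hcover {j} (fun z hz => ⟨j, rfl, le_antisymm ((hmem z).1 hz j) (h z hz)⟩) (-c j)
      (fun i hi => by
        rw [Set.mem_singleton_iff.1 hi, dotProduct_neg, neg_nonpos]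
        exact Finset.sum_nonneg fun i _ => mul_self_nonneg _) j
    rw [dotProduct_neg, neg_eq_zero] at h0
    exact hc j (dotProduct_self_eq_zero.1 h0)
  -- Two distinct lattice points on the line of one inequality suffice.
  have htwo : ∀ j, ∀ z w : Fin 2 → ℤ, intVec z ∈ L → intVec w ∈ L → z ≠ w →
      c j ⬝ᵥ z = e j → c j ⬝ᵥ w = e j → ∃ p u v : Fin 2 → ℤ,
        intVec p ∈ L ∧ intVec (p + u) ∈ L ∧ intVec (p + v) ∈ L ∧ cross u v ≠ 0 := by
    intro j z w hz hw hzw hjz hjw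
    obtain ⟨y, hy, hjy⟩ := hone j
    refine ⟨z, w - z, y - z, hz, by simpa using hw, by simpa using hy, fun h0 => hzw ?_⟩
    simp only [dotProduct, Fin.sum_univ_two, cross, Pi.sub_apply] at *
    have h1 : c j 0 * (w 0 - z 0) + c j 1 * (w 1 - z 1) = 0 := by linarith
    have h2 : c j 0 * (y 0 - z 0) + c j 1 * (y 1 - z 1) ≠ 0 := by
      intro h
      linarith
    have h3 : (w 0 - z 0) * (c j 0 * (y 0 - z 0) + c j 1 * (y 1 - z 1)) = 0 := by
      linear_combination (y 0 - z 0) * h1 + c j 1 * h0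
    have h4 : (w 1 - z 1) * (c j 0 * (y 0 - z 0) + c j 1 * (y 1 - z 1)) = 0 := by
      linear_combination (y 1 - z 1) * h1 - c j 0 * h0
    have h5 := (mul_eq_zero.1 h3).resolve_right h2
    have h6 := (mul_eq_zero.1 h4).resolve_right h2
    ext i
    fin_cases i
    · simp only [Fin.zero_eta]; linarith
    · simp only [Fin.mk_one]; linarith
  obtain ⟨z₁, hz₁, -⟩ := hone (Classical.arbitrary ι)
  obtain ⟨j₁, hj₁⟩ := htight z₁ hz₁
  obtain ⟨z₂, hz₂, hj₁z₂⟩ := hone j₁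
  obtain ⟨j₂, hj₂⟩ := htight z₂ hz₂
  by_cases hcov : ∀ z : Fin 2 → ℤ, intVec z ∈ L → c j₁ ⬝ᵥ z = e j₁ ∨ c j₂ ⬝ᵥ z = e j₂
  · have hcov' : ∀ z : Fin 2 → ℤ, intVec z ∈ L → ∃ j ∈ ({j₁, j₂} : Set ι), c j ⬝ᵥ z = e j := by
      intro z hz
      rcases hcov z hz with h | h
      · exact ⟨j₁, by simp, h⟩
      · exact ⟨j₂, by simp, h⟩
    by_cases hD : cross (c j₁) (c j₂) = 0
    · -- Parallel lines: `L` is invariant under translation along them.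
      have hv := hcover _ hcov' ![-c j₁ 1, c j₁ 0] (by
        intro j hj
        rcases hj with rfl | rfl
        · simp [dotProduct, Fin.sum_univ_two]; linarith
        · simp only [cross] at hD
          simp [dotProduct, Fin.sum_univ_two]; linarith)
      refine ⟨z₁, ![-c j₁ 1, c j₁ 0], z₂ - z₁, hz₁, ?_, by simpa using hz₂, ?_⟩
      · rw [hmem]
        intro k
        rw [dotProduct_add, hv k, add_zero]
        exact (hmem z₁).1 hz₁ k
      · simp only [dotProduct, Fin.sum_univ_two] at hj₁ hj₁z₂
        simp only [cross, Pi.sub_apply, Matrix.cons_val_zero, Matrix.cons_val_one]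
        intro h
        linarith
    · -- Crossing lines: the vector below enters both half-planes.
      exfalso
      have hsq := sq_nonneg (c j₁ 0 * c j₂ 1 - c j₁ 1 * c j₂ 0)
      have hv := hcover _ hcov' ![-cross (c j₁) (c j₂) * (c j₂ 1 - c j₁ 1),
          -cross (c j₁) (c j₂) * (c j₁ 0 - c j₂ 0)] (by
        intro j hj
        rcases hj with rfl | rfl <;>
        · simp only [dotProduct, Fin.sum_univ_two, Matrix.cons_val_zero, Matrix.cons_val_one, cross]
          nlinarith [hsq])
        j₁
      apply hD
      have h2 : cross (c j₁) (c j₂) ^ 2 = 0 := by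
        simp only [dotProduct, Fin.sum_univ_two, Matrix.cons_val_zero, Matrix.cons_val_one,
          cross] at hv ⊢
        linear_combination -hv
      exact pow_eq_zero_iff (two_ne_zero) |>.1 h2
  · push Not at hcov
    obtain ⟨z₃, hz₃, h31, h32⟩ := hcov
    obtain ⟨j₃, hj₃⟩ := htight z₃ hz₃
    by_cases h0 : cross (z₂ - z₁) (z₃ - z₁) = 0
    · -- Collinear points: the inequality tight at the middle one is tight at two of the points.
      have hmid : ∀ j, ∀ x y z : Fin 2 → ℤ, intVec x ∈ L → intVec y ∈ L → intVec z ∈ L →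
          c j ⬝ᵥ x = e j → cross (y - x) (z - x) = 0 → (y - x) ⬝ᵥ (z - x) < 0 →
          ∃ p u v : Fin 2 → ℤ,
            intVec p ∈ L ∧ intVec (p + u) ∈ L ∧ intVec (p + v) ∈ L ∧ cross u v ≠ 0 := by
        intro j x y z hx hy hz hj hcr hdot
        have hcy := (hmem y).1 hy j
        have hcz := (hmem z).1 hz j
        have h := dotProduct_eq_zero_of_opposite (a := c j) hcr hdot
          (by rw [dotProduct_sub]; linarith) (by rw [dotProduct_sub]; linarith)
        refine htwo j x y hx hy ?_ hj (by rw [dotProduct_sub] at h; linarith)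
        rintro rfl
        simp at hdot
      have h21 : z₂ ≠ z₁ := by
        rintro rfl
        exact hj₁z₂.ne hj₁
      have h31' : z₃ ≠ z₁ := by
        rintro rfl
        exact h31 hj₁
      have h32' : z₃ ≠ z₂ := by
        rintro rfl
        exact h32 hj₂
      rcases exists_between_of_cross_eq_zero (sub_ne_zero.2 h21) (sub_ne_zero.2 h31')
        (fun h => h32' (sub_left_injective h).symm) h0 with h | h | h
      · exact hmid j₁ z₁ z₂ z₃ hz₁ hz₂ hz₃ hj₁ h0 h
      · refine hmid j₂ z₂ z₁ z₃ hz₂ hz₁ hz₃ hj₂ ?_ (by simpa using h)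
        simp only [cross, Pi.sub_apply] at h0 ⊢
        linear_combination -h0
      · refine hmid j₃ z₃ z₁ z₂ hz₃ hz₁ hz₂ hj₃ ?_ (by simpa using h)
        simp only [cross, Pi.sub_apply] at h0 ⊢
        linear_combination h0
    · exact ⟨z₁, z₂ - z₁, z₃ - z₁, hz₁, by simpa using hz₂, by simpa using hz₃, h0⟩

/-- A lattice triangle that is not unimodular contains a smaller one: the lattice spanned by the
edge vectors `u`, `v` is proper, so some lattice vector `w` lies in their half-open fundamental
parallelogram; either `w` or its reflection `u + v - w` lies in the triangle. -/
lemma exists_smaller_triangle {L : Set (Fin 2 → ℝ)} (hL : Convex ℝ L) {p u v : Fin 2 → ℤ}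
    (hp : intVec p ∈ L) (hu : intVec (p + u) ∈ L) (hv : intVec (p + v) ∈ L)
    (hD : 1 < cross u v) :
    ∃ u' v' : Fin 2 → ℤ, intVec (p + u') ∈ L ∧ intVec (p + v') ∈ L ∧
      0 < cross u' v' ∧ cross u' v' < cross u v := by
  set D := cross u v with hDdef
  have hD0 : 0 < D := by linarith
  -- Cramer's rule: `D w = s u + t v` with `s = cross w v` and `t = cross u w`.
  have hcramer : ∀ (w : Fin 2 → ℤ) (i : Fin 2), D * w i = cross w v * u i + cross u w * v i := by
    intro w i
    fin_cases i <;> simp only [hDdef, cross, Fin.zero_eta, Fin.mk_one] <;> ring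
  have htri : ∀ w : Fin 2 → ℤ, 0 ≤ cross w v → 0 ≤ cross u w → cross w v + cross u w ≤ D →
      intVec (p + w) ∈ L := by
    intro w hs ht hst
    have hDR : (0 : ℝ) < D := by exact_mod_cast hD0
    have hsR : (0 : ℝ) ≤ cross w v := by exact_mod_cast hs
    have htR : (0 : ℝ) ≤ cross u w := by exact_mod_cast ht
    have hstR : (cross w v : ℝ) + cross u w ≤ D := by exact_mod_cast hst
    have h := hL.sum_mem (t := Finset.univ)
      (w := ![((D : ℝ) - cross w v - cross u w) / D, cross w v / D, cross u w / D])
      (z := ![intVec p, intVec (p + u), intVec (p + v)]) (by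
        intro i _
        fin_cases i
        · exact div_nonneg (by linarith) hDR.le
        · exact div_nonneg hsR hDR.le
        · exact div_nonneg htR hDR.le) (by
        simp only [Fin.sum_univ_three, Matrix.cons_val_zero, Matrix.cons_val_one, Matrix.cons_val]
        field_simp
        ring) (by
        intro i _
        fin_cases i
        · exact hp
        · exact hu
        · exact hv)
    convert h using 1
    ext i
    have hw : (D : ℝ) * w i = cross w v * u i + cross u w * v i := by exact_mod_cast hcramer w i
    simp only [Fin.sum_univ_three, Matrix.cons_val_zero, Matrix.cons_val_one, Matrix.cons_val,
      Pi.add_apply, Pi.smul_apply, smul_eq_mul, intVec]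
    push_cast
    field_simp
    linear_combination hw
  obtain ⟨w, hs, hs', ht, ht', hne⟩ : ∃ w : Fin 2 → ℤ, 0 ≤ cross w v ∧ cross w v < D ∧
      0 ≤ cross u w ∧ cross u w < D ∧ (cross w v ≠ 0 ∨ cross u w ≠ 0) := by
    -- Reduction of a lattice vector `x` modulo `u` and `v`.
    let red : (Fin 2 → ℤ) → Fin 2 → ℤ := fun x => x - (cross x v / D) • u - (cross u x / D) • v
    have hr1 : ∀ x, cross (red x) v = cross x v % D := by
      intro x
      have hlin : cross (red x) v = cross x v - cross x v / D * D := by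
        simp only [hDdef, red, cross, Pi.sub_apply, Pi.smul_apply, smul_eq_mul]
        ring
      rw [hlin, Int.emod_def, mul_comm D]
    have hr2 : ∀ x, cross u (red x) = cross u x % D := by
      intro x
      have hlin : cross u (red x) = cross u x - cross u x / D * D := by
        simp only [hDdef, red, cross, Pi.sub_apply, Pi.smul_apply, smul_eq_mul]
        ring
      rw [hlin, Int.emod_def, mul_comm D]
    obtain ⟨x, hx⟩ : ∃ x : Fin 2 → ℤ, cross x v % D ≠ 0 ∨ cross u x % D ≠ 0 := by
      by_contra! h
      obtain ⟨a, ha⟩ := Int.dvd_of_emod_eq_zero (h ![1, 0]).1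
      obtain ⟨b, hb⟩ := Int.dvd_of_emod_eq_zero (h ![1, 0]).2
      obtain ⟨a', ha'⟩ := Int.dvd_of_emod_eq_zero (h ![0, 1]).1
      obtain ⟨b', hb'⟩ := Int.dvd_of_emod_eq_zero (h ![0, 1]).2
      simp only [cross, Matrix.cons_val_zero, Matrix.cons_val_one, one_mul, zero_mul, mul_one,
        mul_zero, sub_zero, zero_sub] at ha hb ha' hb'
      have hDD : D * 1 = D * (D * (a * b' - a' * b)) := by
        have : D = u 0 * v 1 - u 1 * v 0 := hDdef
        linear_combination this + v 1 * hb' + D * b' * ha + v 0 * hb - D * b * ha'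
      have h1 : D ∣ 1 := ⟨_, mul_left_cancel₀ hD0.ne' hDD⟩
      have := Int.le_of_dvd one_pos h1
      linarith
    refine ⟨red x, ?_, ?_, ?_, ?_, ?_⟩
    · rw [hr1]; exact Int.emod_nonneg _ hD0.ne'
    · rw [hr1]; exact Int.emod_lt_of_pos _ hD0
    · rw [hr2]; exact Int.emod_nonneg _ hD0.ne'
    · rw [hr2]; exact Int.emod_lt_of_pos _ hD0
    · rwa [hr1, hr2]
  have hfin : ∀ w : Fin 2 → ℤ, 0 ≤ cross w v → cross w v < D → 0 ≤ cross u w → cross u w < D →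
      (cross w v ≠ 0 ∨ cross u w ≠ 0) → cross w v + cross u w ≤ D →
      ∃ u' v' : Fin 2 → ℤ, intVec (p + u') ∈ L ∧ intVec (p + v') ∈ L ∧
        0 < cross u' v' ∧ cross u' v' < D := by
    intro w hs hs' ht ht' hne hle
    rcases hne with h | h
    · exact ⟨w, v, htri w hs ht hle, hv, lt_of_le_of_ne hs h.symm, hs'⟩
    · exact ⟨u, w, hu, htri w hs ht hle, lt_of_le_of_ne ht h.symm, ht'⟩
  by_cases hle : cross w v + cross u w ≤ D
  · exact hfin w hs hs' ht ht' hne hle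
  · have h1 : cross (u + v - w) v = D - cross w v := by
      simp only [hDdef, cross, Pi.sub_apply, Pi.add_apply]; ring
    have h2 : cross u (u + v - w) = D - cross u w := by
      simp only [hDdef, cross, Pi.sub_apply, Pi.add_apply]; ring
    push Not at hle
    refine hfin (u + v - w) ?_ ?_ ?_ ?_ (Or.inl ?_) ?_ <;> simp only [h1, h2] <;> omega

lemma exists_unimodular_triangle {L : Set (Fin 2 → ℝ)} (hL : Convex ℝ L) {p u v : Fin 2 → ℤ}
    (hp : intVec p ∈ L) (hu : intVec (p + u) ∈ L) (hv : intVec (p + v) ∈ L)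
    (hD : cross u v ≠ 0) :
    ∃ u' v' : Fin 2 → ℤ, intVec (p + u') ∈ L ∧ intVec (p + v') ∈ L ∧ cross u' v' = 1 := by
  have key : ∀ (n : ℕ) (u v : Fin 2 → ℤ), intVec (p + u) ∈ L → intVec (p + v) ∈ L →
      0 < cross u v → (cross u v).toNat = n →
      ∃ u' v' : Fin 2 → ℤ, intVec (p + u') ∈ L ∧ intVec (p + v') ∈ L ∧ cross u' v' = 1 := by
    intro n
    induction n using Nat.strong_induction_on with
    | _ n ih =>
      intro u v hu hv hpos hn
      rcases eq_or_lt_of_le (Int.add_one_le_iff.2 hpos) with h1 | h1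
      · exact ⟨u, v, hu, hv, by linarith⟩
      · obtain ⟨u', v', hu', hv', hpos', hlt⟩ :=
          exists_smaller_triangle hL hp hu hv (by simpa using h1)
        exact ih _ (by omega) u' v' hu' hv' hpos' rfl
  rcases lt_or_gt_of_ne hD with h | h
  · exact key _ v u hv hu (by simp only [cross] at h ⊢; linarith) rfl
  · exact key _ u v hu hv h rfl

/-! ### Finiteness -/

/-- A set with a representation of width `m` containing `0`, `e₁`, `e₂` has all normals in
`[-m, m]²` and all right-hand sides in `[0, m]`. -/
lemma finite_hasFacetWidthRep (m : ℕ) :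
    {Y : Set (Fin 2 → ℝ) | HasFacetWidthRep Y m ∧ intVec 0 ∈ Y ∧ intVec ![1, 0] ∈ Y ∧
      intVec ![0, 1] ∈ Y}.Finite := by
  let F : Set ((Fin 2 → ℤ) × ℤ) :=
    Set.Icc (fun _ => -(m : ℤ)) (fun _ => (m : ℤ)) ×ˢ Set.Icc 0 (m : ℤ)
  have hF : F.Finite := (Set.finite_Icc _ _).prod (Set.finite_Icc _ _)
  let poly : Set ((Fin 2 → ℤ) × ℤ) → Set (Fin 2 → ℝ) := fun S =>
    {x | ∀ q ∈ S, (q.2 : ℝ) - (m : ℝ) ≤ intVec q.1 ⬝ᵥ x ∧ intVec q.1 ⬝ᵥ x ≤ (q.2 : ℝ)}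
  refine (hF.finite_subsets.image poly).subset ?_
  rintro Y ⟨⟨n, a, b, -, -, rfl⟩, h0, h1, h2⟩
  refine ⟨Set.range fun i => (a i, b i), ?_, ?_⟩
  · rintro _ ⟨i, rfl⟩
    have h0' := h0 i
    have h1' := h1 i
    have h2' := h2 i
    rw [intVec_dotProduct_intVec] at h0' h1' h2'
    simp only [dotProduct, Fin.sum_univ_two, Pi.zero_apply, Matrix.cons_val_zero,
      Matrix.cons_val_one, mul_zero, mul_one, add_zero, zero_add] at h0' h1' h2'
    norm_cast at h0' h1' h2'
    refine ⟨⟨fun j => ?_, fun j => ?_⟩, ?_, ?_⟩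
    · fin_cases j <;> simp only [Fin.zero_eta, Fin.mk_one] <;> omega
    · fin_cases j <;> simp only [Fin.zero_eta, Fin.mk_one] <;> omega
    · simp only; omega
    · simp only; omega
  · ext x
    exact Set.forall_mem_range

/-- A planar maximal lattice-free set of facet width `m` contains a unimodular lattice triangle,
which an equivalence moves to the standard one. -/
lemma IsMaximalLatticeFree.exists_normal_form {L : Set (Fin 2 → ℝ)} (hL : IsMaximalLatticeFree L)
    {m : ℕ} (hm : HasFacetWidthRep L m) :
    ∃ Y : Set (Fin 2 → ℝ), IsIntEquivalent L Y ∧ HasFacetWidthRep Y m ∧ intVec 0 ∈ Y ∧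
      intVec ![1, 0] ∈ Y ∧ intVec ![0, 1] ∈ Y := by
  obtain ⟨n, a, b, hn, ha, hrep⟩ := id hm
  have : Nonempty (Fin n) := ⟨⟨0, hn⟩⟩
  obtain ⟨p, u, v, hp, hu, hv, hD⟩ := hL.exists_noncollinear (ι := Fin n ⊕ Fin n)
    (Sum.elim a fun i => -a i) (Sum.elim b fun i => m - b i)
    (by rintro (i | i) <;> simp [ha i])
    (by
      rintro (i | i)
      · exact ⟨Sum.inr i, rfl⟩
      · exact ⟨Sum.inl i, by simp⟩)
    (by
      rw [hrep]
      ext x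
      have hnegv : ∀ i, intVec (-a i) = -intVec (a i) := fun i => by ext j; simp [intVec]
      simp only [Set.mem_ofPred_eq, Sum.forall, Sum.elim_inl, Sum.elim_inr, hnegv, neg_dotProduct]
      push_cast
      constructor
      · exact fun h => ⟨fun i => (h i).2, fun i => by linarith [(h i).1]⟩
      · exact fun h i => ⟨by linarith [h.2 i], h.1 i⟩)
  obtain ⟨u, v, hu, hv, hD⟩ := exists_unimodular_triangle hL.prop.convex hp hu hv hD
  let U : Matrix (Fin 2) (Fin 2) ℤ := !![v 1, -v 0; -u 1, u 0]
  have hdet : U.det = 1 := by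
    rw [Matrix.det_fin_two_of, ← hD]
    simp only [cross]
    ring
  have happ : ∀ z : Fin 2 → ℤ, (U.map (Int.cast : ℤ → ℝ)) *ᵥ intVec z + intVec (-(U *ᵥ p)) =
      intVec (U *ᵥ (z - p)) := by
    intro z
    ext j
    simp only [intVec, Matrix.mulVec, dotProduct, Fin.sum_univ_two, Matrix.map_apply, Pi.add_apply,
      Pi.neg_apply, Pi.sub_apply]
    push_cast
    ring
  have heq : IsIntEquivalent L
      ((fun x => (U.map (Int.cast : ℤ → ℝ)) *ᵥ x + intVec (-(U *ᵥ p))) '' L) :=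
    ⟨U, -(U *ᵥ p), Or.inl hdet, rfl⟩
  simp only [cross] at hD
  refine ⟨_, heq, hm.of_isIntEquivalent heq, ⟨_, hp, ?_⟩, ⟨_, hu, ?_⟩, ⟨_, hv, ?_⟩⟩
  · simp only [happ]
    simp
  · simp only [happ, add_sub_cancel_left]
    congr 1
    ext j
    fin_cases j <;> simp [U, Matrix.mulVec, dotProduct, Fin.sum_univ_two] <;> linarith
  · simp only [happ, add_sub_cancel_left]
    congr 1
    ext j
    fin_cases j <;> simp [U, Matrix.mulVec, dotProduct, Fin.sum_univ_two] <;> linarith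

lemma maxFacetWidth_eq {d : ℕ} {L : Set (Fin d → ℝ)} (huniv : L ≠ Set.univ)
    (hlin : RecessionConeIsLinear L) :
    maxFacetWidth L = ⨅ (m : ℕ) (_ : 0 < m ∧ HasFacetWidthRep L m), (m : ℕ∞) := by
  rw [maxFacetWidth, if_neg]
  simp [huniv, hlin]

lemma exists_hasFacetWidthRep_of_maxFacetWidth_lt {d : ℕ} {L : Set (Fin d → ℝ)} {M : ℕ∞}
    (h : maxFacetWidth L < M) : ∃ m : ℕ, (m : ℕ∞) < M ∧ HasFacetWidthRep L m := by
  rw [maxFacetWidth] at h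
  split_ifs at h
  · exact absurd h not_top_lt
  · simp only [iInf_lt_iff] at h
    obtain ⟨m, ⟨-, hm⟩, hlt⟩ := h
    exact ⟨m, hlt, hm⟩

end LatticeFree

open LatticeFree in
theorem corollary2 (𝓛 : Set (Set (Fin 2 → ℝ)))
    (h𝓛 : ∀ L ∈ 𝓛, LatticeFree.IsMaximalLatticeFree L ∧ LatticeFree.IsRationalPolyhedron L) :
    LatticeFree.familyMaxFacetWidth 𝓛 < ⊤ ↔ LatticeFree.IsFiniteUpToIntEquivalence 𝓛 := by
  constructor
  · -- Bounded width: the normal forms range over a finite set.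
    intro h
    obtain ⟨M, hM⟩ := ENat.ne_top_iff_exists.1 h.ne
    have hfin : (⋃ m ∈ Set.Iio (M + 1), {Y : Set (Fin 2 → ℝ) | HasFacetWidthRep Y m ∧
        intVec 0 ∈ Y ∧ intVec ![1, 0] ∈ Y ∧ intVec ![0, 1] ∈ Y}).Finite :=
      (Set.finite_Iio _).biUnion fun m _ => finite_hasFacetWidthRep m
    obtain ⟨t, Y, -, hY⟩ := hfin.fin_param
    refine ⟨t, Y, fun L hL => ?_⟩
    have hle : maxFacetWidth L ≤ M := by
      rw [hM]
      exact le_iSup₂ (f := fun L (_ : L ∈ 𝓛) => maxFacetWidth L) L hL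
    obtain ⟨m, hmM, hm⟩ := exists_hasFacetWidthRep_of_maxFacetWidth_lt (M := ((M + 1 : ℕ) : ℕ∞))
      (hle.trans_lt (by exact_mod_cast Nat.lt_succ_self M))
    obtain ⟨Z, hLZ, hZ⟩ := (h𝓛 L hL).1.exists_normal_form hm
    have : Z ∈ Set.range Y := by
      rw [hY]
      exact Set.mem_biUnion (show m ∈ Set.Iio (M + 1) by exact_mod_cast hmM) hZ
    obtain ⟨i, rfl⟩ := this
    exact ⟨i, hLZ⟩
  · -- Finitely many classes: each has finite width, which is an invariant of the class.
    rintro ⟨t, Y, hY⟩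
    have hlin : ∀ L ∈ 𝓛, RecessionConeIsLinear L := fun L hL => (h𝓛 L hL).1.recessionConeIsLinear
    have hbound : ∀ i, ∃ m : ℕ, ∀ L ∈ 𝓛, IsIntEquivalent L (Y i) →
        0 < m ∧ HasFacetWidthRep L m := by
      intro i
      by_cases h : ∃ L ∈ 𝓛, IsIntEquivalent L (Y i)
      · obtain ⟨L, hL, hLY⟩ := h
        obtain ⟨m, hm0, hm⟩ := (h𝓛 L hL).2.exists_hasFacetWidthRep
          ((h𝓛 L hL).1.prop.interior_nonempty.mono interior_subset) (h𝓛 L hL).1.prop.ne_univ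
          (hlin L hL)
        exact ⟨m, fun K _ hKY =>
          ⟨hm0, (hm.of_isIntEquivalent hLY).of_isIntEquivalent hKY.symm⟩⟩
      · exact ⟨0, fun K hK hKY => absurd ⟨K, hK, hKY⟩ h⟩
    choose m hm using hbound
    refine lt_of_le_of_lt (iSup₂_le fun L hL => ?_) (ENat.natCast_lt_top (∑ i, m i))
    obtain ⟨i, hi⟩ := hY L hL
    rw [maxFacetWidth_eq (h𝓛 L hL).1.prop.ne_univ (hlin L hL)]
    refine (iInf₂_le (m i) (hm i L hL hi)).trans ?_
    exact_mod_cast Finset.single_le_sum (fun _ _ => Nat.zero_le _) (Finset.mem_univ i)
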